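/- Let $G$ be a nontrivial connected compact (Hausdorff) abelian group with character group $X$, and let $T\subseteq X$ be a subsemigroup with $\mathbf 1\in T$, $T\cap T^{-1}=\{\mathbf 1\}$ and $X=T^{-1}T$. Order $X$ by $\xi\le\chi :\Leftrightarrow \chi\xi^{-1}\in T$; $X$ is called linearly ordered if $T\cup T^{-1}=X$. A character $\chi$ has rotation index $\operatorname{ind}\chi=\#(T\setminus\chi T)$ if $\chi\in T$ and $T\setminus\chi T$ is finite, and $\operatorname{ind}\chi=\operatorname{ind}\chi_1-\operatorname{ind}\chi_2$ if $\chi=\chi_1\chi_2^{-1}$ with $\chi_1,\chi_2\in T$ and both sets $T\setminus\chi_jT$ finite; otherwise $\chi$ has no index. Let $X^i$ be the set of characters having an index. Let $C(G)^{-1}$ be the group of invertible elements of the Banach algebra $C(G)$ of continuous functions $G\to\mathbb C$. A function $\varphi\in C(G)^{-1}$ of the form $\varphi=\chi e^{g}$ with $\chi\in X^i$, $g\in C(G)$ has index $\operatorname{ind}\varphi=\operatorname{ind}\chi$; let $\Phi(G)=X^i\cdot\exp(C(G))$ be the set of all such functions. Then: 1) $X^i$ is a convex subgroup of $X$ (if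 $\xi_1,\xi_2\in X^i$ and $\xi_1\le\xi\le\xi_2$, then $\xi\in X^i$). 2) The map $\operatorname{ind}:X^i\to\mathbb Z$ is well defined and is an order-preserving homomorphism onto a group of the form $a\mathbb Z$ with an integer $a\ge 0$; if $X$ is linearly ordered and $X^i$ is nontrivial, it is an order isomorphism of $X^i$ onto $\mathbb Z$. 3) $\Phi(G)$ is an open subgroup of $C(G)^{-1}$; it is the disjoint union of the sets $\chi\exp(C(G))$, $\chi\in X^i$, and these sets are open and are its connected components. 4) The map $\operatorname{ind}:\Phi(G)\to\mathbb Z$ is a well-defined group homomorphism and takes the constant value $\operatorname{ind}\chi$ on the component $\chi\exp(C(G))$ for every $\chi\in X^i$. 5) If $X$ is linearly ordered, then for every continuous homomorphism $\gamma:\mathbb T\to G$ with $X^i\not\subseteq\gamma(\mathbb T)^{\perp}$ (that is, some $\chi\in X^i$ is not identically $1$ on $\gamma(\mathbb T)$) there is an integer $k_\gamma\neq 0$ such that $$\operatorname{ind}\varphi=k_\gamma^{-1}\,\mathrm{wn}(\varphi\circ\gamma)\qquad\text{for all }\varphi\in\Phi(G),$$ where $\mathrm{wn}$ is the classical winding number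 about $0$ of nowhere vanishing continuous functions on $\mathbb T$. -/

import Mathlib

/-- The order defined by the cone `T`: `ξ ≤ χ` iff `χ * ξ⁻¹ ∈ T`. -/
def ConeLE {X : Type*} [CommGroup X] (T : GroupCone X) (ξ χ : X) : Prop :=
  χ * ξ⁻¹ ∈ T

/-- The cone `T` generates `X`: `X = T⁻¹ T`. -/
def ConeGenerates {X : Type*} [CommGroup X] (T : GroupCone X) : Prop :=
  ∀ χ : X, ∃ a ∈ T, ∃ b ∈ T, χ = a⁻¹ * b

/-- The order defined by `T` is linear: `T ∪ T⁻¹ = X`. -/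
def ConeLinear {X : Type*} [CommGroup X] (T : GroupCone X) : Prop :=
  ∀ χ : X, χ ∈ T ∨ χ⁻¹ ∈ T

/-- The set `T \ χT`. -/
def coneGap {X : Type*} [CommGroup X] (T : GroupCone X) (χ : X) : Set X :=
  (T : Set X) \ ((fun ξ : X => χ * ξ) '' (T : Set X))

/-- `IsCharIndex T χ n`: the integer `n` is a value of the rotation index of `χ` according to one
of the two clauses of its definition. That `n` is determined by `χ` is part of the theorem. -/
inductive IsCharIndex {X : Type*} [CommGroup X] (T : GroupCone X) : X → ℤ → Prop
  | of_mem (χ : X) (hχ : χ ∈ T) (hfin : (coneGap T χ).Finite) :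
      IsCharIndex T χ ((coneGap T χ).ncard : ℤ)
  | of_div (χ₁ χ₂ : X) (h₁ : χ₁ ∈ T) (h₂ : χ₂ ∈ T)
      (hfin₁ : (coneGap T χ₁).Finite) (hfin₂ : (coneGap T χ₂).Finite) :
      IsCharIndex T (χ₁ * χ₂⁻¹) (((coneGap T χ₁).ncard : ℤ) - ((coneGap T χ₂).ncard : ℤ))

/-- The set `X^i` of the elements of `X` that have a rotation index. -/
def indexedChars {X : Type*} [CommGroup X] (T : GroupCone X) : Set X :=
  {χ | ∃ n : ℤ, IsCharIndex T χ n}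

open Classical in
/-- The rotation index of `χ` (with value `0` outside `X^i`). -/
noncomputable def charInd {X : Type*} [CommGroup X] (T : GroupCone X) (χ : X) : ℤ :=
  if h : ∃ n : ℤ, IsCharIndex T χ n then h.choose else 0

/-- The set `χ · exp C(G)` in the group `C(G)⁻¹` of invertible continuous functions. -/
def expCoset {G : Type*} [CommGroup G] [TopologicalSpace G]
    (χ : PontryaginDual G) : Set (C(G, ℂ)ˣ) :=
  {φ | ∃ g : C(G, ℂ), ∀ x : G, (φ : C(G, ℂ)) x = (χ x : ℂ) * Complex.exp (g x)}

/-- `IsFunIndex T φ n`: there is a decomposition `φ = χ e^g` with a character `χ` of index `n`. -/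
def IsFunIndex {G : Type*} [CommGroup G] [TopologicalSpace G]
    (T : GroupCone (PontryaginDual G)) (φ : C(G, ℂ)ˣ) (n : ℤ) : Prop :=
  ∃ χ : PontryaginDual G, φ ∈ expCoset χ ∧ IsCharIndex T χ n

/-- The set `Φ(G)` of the invertible continuous functions that have an index. -/
def indexedFuns {G : Type*} [CommGroup G] [TopologicalSpace G]
    (T : GroupCone (PontryaginDual G)) : Set (C(G, ℂ)ˣ) :=
  {φ | ∃ n : ℤ, IsFunIndex T φ n}

open Classical in
/-- The rotation index of `φ` (with value `0` outside `Φ(G)`). -/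
noncomputable def funInd {G : Type*} [CommGroup G] [TopologicalSpace G]
    (T : GroupCone (PontryaginDual G)) (φ : C(G, ℂ)ˣ) : ℤ :=
  if h : ∃ n : ℤ, IsFunIndex T φ n then h.choose else 0

/-- The annihilator of a subset of `G` in the group of characters. -/
def charAnnihilator {G : Type*} [CommGroup G] [TopologicalSpace G]
    (H : Set G) : Set (PontryaginDual G) :=
  {χ | ∀ x ∈ H, χ x = 1}

/-- `n` is the winding number of `f` about `0`: for a continuous logarithm `g` of `t ↦ f (e^{it})`
one has `g (2π) - g 0 = 2πi n`. -/
def IsWindingNumber (f : C(Circle, ℂ)ˣ) (n : ℤ) : Prop :=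
  ∃ g : C(ℝ, ℂ), (∀ t : ℝ, (f : C(Circle, ℂ)) (Circle.exp t) = Complex.exp (g t)) ∧
    g (2 * Real.pi) - g 0 = 2 * (Real.pi : ℂ) * Complex.I * (n : ℂ)

/-- The winding number exists and is unique. -/
theorem existsUnique_isWindingNumber (f : C(Circle, ℂ)ˣ) : ∃! n : ℤ, IsWindingNumber f n := by
  have hf : ∀ z : Circle, (f : C(Circle, ℂ)) z ≠ 0 := by
    intro z hz
    have h : (f : C(Circle, ℂ)) z * ((f⁻¹ : C(Circle, ℂ)ˣ) : C(Circle, ℂ)) z = 1 := by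
      rw [← ContinuousMap.mul_apply, f.mul_inv, ContinuousMap.one_apply]
    exact zero_ne_one (by rwa [hz, zero_mul] at h)
  have h2pi : (2 * (Real.pi : ℂ) * Complex.I) ≠ 0 := by
    simp [Real.pi_ne_zero, Complex.I_ne_zero]
  obtain ⟨g, ⟨-, hg⟩, -⟩ := Complex.isCoveringMapOn_exp.existsUnique_continuousMap_lifts
    ((f : C(Circle, ℂ)).comp (Circle.exp : C(ℝ, Circle))) (a₀ := (0 : ℝ))
    (Complex.exp_log (hf (Circle.exp 0))) (fun t => hf _)
  have hg' : ∀ t : ℝ, (f : C(Circle, ℂ)) (Circle.exp t) = Complex.exp (g t) :=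
    fun t => (congrFun hg t).symm
  have hper : Complex.exp (g (2 * Real.pi)) = Complex.exp (g 0) := by
    rw [← hg', ← hg', Circle.exp_two_pi, Circle.exp_zero]
  obtain ⟨n, hn⟩ := Complex.exp_eq_exp_iff_exists_int.1 hper
  refine ⟨n, ⟨g, hg', by rw [hn]; ring⟩, ?_⟩
  rintro m ⟨k, hk, hm⟩
  obtain ⟨c, hc⟩ := Complex.exp_eq_exp_iff_exists_int.1 ((hk 0).symm.trans (hg' 0))
  obtain ⟨F, -, hF⟩ := Complex.isCoveringMapOn_exp.existsUnique_continuousMap_lifts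
    ((f : C(Circle, ℂ)).comp (Circle.exp : C(ℝ, Circle))) (a₀ := (0 : ℝ)) (e₀ := k 0)
    (hk 0).symm (fun t => hf _)
  have h1 : k = F := hF k ⟨rfl, funext fun t => (hk t).symm⟩
  have h2 : g + ContinuousMap.const ℝ ((c : ℂ) * (2 * Real.pi * Complex.I)) = F := by
    refine hF _ ⟨by simp [hc], funext fun t => ?_⟩
    have : Complex.exp ((c : ℂ) * (2 * Real.pi * Complex.I)) = 1 :=
      Complex.exp_int_mul_two_pi_mul_I c
    simp [Complex.exp_add, this, hg']
  rw [h1, ← h2] at hm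
  have h3 : (2 * (Real.pi : ℂ) * Complex.I) * (m : ℂ) = (2 * (Real.pi : ℂ) * Complex.I) * n := by
    rw [← hm]
    simp only [ContinuousMap.add_apply, ContinuousMap.const_apply, hn]
    ring
  exact_mod_cast mul_left_cancel₀ h2pi h3

/-- The classical winding number `wn f` of a nowhere vanishing continuous function on the circle. -/
noncomputable def windingNumber (f : C(Circle, ℂ)ˣ) : ℤ :=
  (existsUnique_isWindingNumber f).choose

/-- The invertible function `φ ∘ γ` on the circle. -/
noncomputable def pullbackUnit {G : Type*} [CommGroup G] [TopologicalSpace G]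
    (γ : Circle →ₜ* G) (φ : C(G, ℂ)ˣ) : C(Circle, ℂ)ˣ :=
  Units.map (ContinuousMap.compMonoidHom' (γ : C(Circle, G))) φ

/-!
The index is first studied on an abelian group `X` with a cone `T`. For `a, b ∈ T` the set
`T \ abT` is the disjoint union of `T \ aT` and `a(T \ bT)` (`coneGap_mul`), so that cardinalities
add. This one identity gives that the index is well defined, additive and monotone, and that `X^i`
is a convex subgroup. If the order is linear, `T \ χT` is the order interval `[1, χ)`; it is empty
only for `χ = 1`, and for `χ` of least positive index it is reduced to `1`. Hence the index is an
isomorphism of `X^i` onto `ℤ` as soon as `X^i` is nontrivial (`charInd_injOn`, `charInd_surjOn`).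

For functions, the point is that a nontrivial character of a compact connected group `G` has no
continuous logarithm (`eq_one_of_eq_exp`): up to a constant such a logarithm would be a homomorphism
of `G` into `ℂ`, and its image would be a bounded subgroup. So the cosets `χ · exp C(G)` are
pairwise disjoint. They are connected, as images of the vector space `C(G)`, and clopen, because
`exp C(G)` is a subgroup that contains a ball around `1`. This determines the components of `Φ(G)`
and makes the index of functions well defined.

A homomorphism `γ : 𝕋 → G` gives the homomorphism `χ ↦ wn (χ ∘ γ)`. On the infinite cyclic group
`X^i` it is a multiple `k` of the index, and exponentials have winding number `0`, so that
`wn (φ ∘ γ) = k · ind φ` on `Φ(G)`. If `k` were `0`, the continuous logarithm of `χ ∘ γ` along the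
line, which is affine, would be periodic, hence constant, for all `χ ∈ X^i`
(`eq_one_of_pullbackDegree_eq_one`).
-/

/-! ### The rotation index on an ordered abelian group -/

section Cone

variable {X : Type*} [CommGroup X] {T : GroupCone X}

/-- The elements `χ ∈ T` for which `T \ χT` is finite; these are the elements to which the first
clause of the definition of the rotation index applies. -/
def finiteGap (T : GroupCone X) : Set X :=
  {χ | χ ∈ T ∧ (coneGap T χ).Finite}

/-- `T \ χT` consists of the `ξ ∈ T` that do not satisfy `χ ≤ ξ`. -/
theorem mem_coneGap {χ ξ : X} : ξ ∈ coneGap T χ ↔ ξ ∈ T ∧ χ⁻¹ * ξ ∉ T := by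
  simp only [coneGap, Set.mem_sdiff, SetLike.mem_coe, Set.mem_image, not_exists, not_and]
  refine and_congr_right fun _ => ⟨fun h hT => h _ hT (by group), ?_⟩
  rintro h η hη rfl
  exact h (by simpa using hη)

theorem coneGap_one : coneGap T (1 : X) = ∅ := by
  ext ξ; simp [mem_coneGap]

theorem coneGap_mul {a b : X} (ha : a ∈ T) (hb : b ∈ T) :
    coneGap T (a * b) = coneGap T a ∪ (fun ξ => a * ξ) '' coneGap T b := by
  ext ξ
  simp only [Set.mem_union, Set.mem_image, mem_coneGap]
  constructor
  · rintro ⟨h1, h2⟩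
    by_cases h : a⁻¹ * ξ ∈ T
    · exact Or.inr ⟨a⁻¹ * ξ, ⟨h, by rwa [← mul_assoc, ← mul_inv_rev]⟩, by group⟩
    · exact Or.inl ⟨h1, h⟩
  · rintro (⟨h1, h2⟩ | ⟨η, ⟨h1, h2⟩, rfl⟩)
    · refine ⟨h1, fun h => h2 ?_⟩
      convert mul_mem hb h using 1
      rw [mul_inv_rev]; group
    · refine ⟨mul_mem ha h1, fun h => h2 ?_⟩
      convert h using 1
      rw [mul_inv_rev]; group

theorem disjoint_coneGap_image (a b : X) :
    Disjoint (coneGap T a) ((fun ξ => a * ξ) '' coneGap T b) := by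
  rw [Set.disjoint_left]
  rintro _ h ⟨η, hη, rfl⟩
  exact (mem_coneGap.1 h).2 (by simpa using (mem_coneGap.1 hη).1)

theorem one_mem_finiteGap : (1 : X) ∈ finiteGap T :=
  ⟨one_mem T, by simp [coneGap_one]⟩

theorem mul_mem_finiteGap {a b : X} (ha : a ∈ finiteGap T) (hb : b ∈ finiteGap T) :
    a * b ∈ finiteGap T :=
  ⟨mul_mem ha.1 hb.1, by
    rw [coneGap_mul ha.1 hb.1]; exact ha.2.union (hb.2.image _)⟩

/-- The finiteness of `T \ χT` passes to smaller elements of `T`, because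
`T \ aT ⊆ T \ abT`. -/
theorem mem_finiteGap_of_mul {a b : X} (ha : a ∈ T) (hb : b ∈ T) (hab : a * b ∈ finiteGap T) :
    a ∈ finiteGap T :=
  ⟨ha, hab.2.subset (by rw [coneGap_mul ha hb]; exact Set.subset_union_left)⟩

theorem ncard_coneGap_mul {a b : X} (ha : a ∈ finiteGap T) (hb : b ∈ finiteGap T) :
    (coneGap T (a * b)).ncard = (coneGap T a).ncard + (coneGap T b).ncard := by
  rw [coneGap_mul ha.1 hb.1,
    Set.ncard_union_eq (disjoint_coneGap_image a b) ha.2 (hb.2.image _),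
    Set.ncard_image_of_injective _ (mul_right_injective a)]

/-- The first clause of the definition of the rotation index is the case `χ₂ = 1` of the second. -/
theorem isCharIndex_iff {χ : X} {n : ℤ} :
    IsCharIndex T χ n ↔ ∃ a ∈ finiteGap T, ∃ b ∈ finiteGap T, χ = a * b⁻¹ ∧
      n = ((coneGap T a).ncard : ℤ) - ((coneGap T b).ncard : ℤ) := by
  constructor
  · rintro (⟨_, h, hf⟩ | ⟨a, b, ha, hb, hfa, hfb⟩)
    · exact ⟨χ, ⟨h, hf⟩, 1, one_mem_finiteGap, by simp, by simp [coneGap_one]⟩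
    · exact ⟨a, ⟨ha, hfa⟩, b, ⟨hb, hfb⟩, rfl, rfl⟩
  · rintro ⟨a, ha, b, hb, rfl, rfl⟩
    exact .of_div a b ha.1 hb.1 ha.2 hb.2

theorem IsCharIndex.unique {χ : X} {m n : ℤ} (hm : IsCharIndex T χ m) (hn : IsCharIndex T χ n) :
    m = n := by
  obtain ⟨a, ha, b, hb, rfl, rfl⟩ := isCharIndex_iff.1 hm
  obtain ⟨c, hc, d, hd, h, rfl⟩ := isCharIndex_iff.1 hn
  have h1 : a * d = c * b := by
    rwa [← div_eq_mul_inv, ← div_eq_mul_inv, div_eq_div_iff_mul_eq_mul] at h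
  have h2 := ncard_coneGap_mul ha hd
  rw [h1, ncard_coneGap_mul hc hb] at h2
  omega

theorem IsCharIndex.mul {ξ χ : X} {m n : ℤ} (hm : IsCharIndex T ξ m) (hn : IsCharIndex T χ n) :
    IsCharIndex T (ξ * χ) (m + n) := by
  obtain ⟨a, ha, b, hb, rfl, rfl⟩ := isCharIndex_iff.1 hm
  obtain ⟨c, hc, d, hd, rfl, rfl⟩ := isCharIndex_iff.1 hn
  refine isCharIndex_iff.2 ⟨a * c, mul_mem_finiteGap ha hc, b * d, mul_mem_finiteGap hb hd,
    by rw [mul_inv, mul_mul_mul_comm], ?_⟩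
  rw [ncard_coneGap_mul ha hc, ncard_coneGap_mul hb hd]
  push_cast; ring

theorem IsCharIndex.inv {χ : X} {n : ℤ} (hn : IsCharIndex T χ n) : IsCharIndex T χ⁻¹ (-n) := by
  obtain ⟨a, ha, b, hb, rfl, rfl⟩ := isCharIndex_iff.1 hn
  exact isCharIndex_iff.2 ⟨b, hb, a, ha, by rw [mul_inv_rev, inv_inv], by ring⟩

theorem isCharIndex_of_mem_finiteGap {χ : X} (h : χ ∈ finiteGap T) :
    IsCharIndex T χ (coneGap T χ).ncard :=
  .of_mem χ h.1 h.2

variable (T) in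
/-- The set `X^i` as a subgroup. -/
def indexSubgroup : Subgroup X where
  carrier := indexedChars T
  one_mem' := ⟨_, isCharIndex_of_mem_finiteGap one_mem_finiteGap⟩
  mul_mem' := fun ⟨_, hm⟩ ⟨_, hn⟩ => ⟨_, hm.mul hn⟩
  inv_mem' := fun ⟨_, hn⟩ => ⟨_, hn.inv⟩

theorem isCharIndex_charInd {χ : X} (h : χ ∈ indexedChars T) :
    IsCharIndex T χ (charInd T χ) := by
  have h' : ∃ n : ℤ, IsCharIndex T χ n := h
  rw [charInd, dif_pos h']
  exact h'.choose_spec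

theorem IsCharIndex.charInd_eq {χ : X} {n : ℤ} (h : IsCharIndex T χ n) : charInd T χ = n :=
  (isCharIndex_charInd ⟨n, h⟩).unique h

theorem charInd_mul {ξ χ : X} (hξ : ξ ∈ indexedChars T) (hχ : χ ∈ indexedChars T) :
    charInd T (ξ * χ) = charInd T ξ + charInd T χ :=
  ((isCharIndex_charInd hξ).mul (isCharIndex_charInd hχ)).charInd_eq

theorem charInd_inv {χ : X} (hχ : χ ∈ indexedChars T) : charInd T χ⁻¹ = -charInd T χ :=
  (isCharIndex_charInd hχ).inv.charInd_eq

variable (T) in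
/-- The rotation index as a homomorphism on `X^i`. -/
noncomputable def charIndHom : indexSubgroup T →* Multiplicative ℤ where
  toFun χ := Multiplicative.ofAdd (charInd T (χ : X))
  map_one' := by
    rw [Subgroup.coe_one, (isCharIndex_of_mem_finiteGap one_mem_finiteGap).charInd_eq]
    simp [coneGap_one]
  map_mul' ξ χ := by rw [Subgroup.coe_mul, charInd_mul ξ.2 χ.2, ofAdd_add]

/-- On `T`, an element has an index only through the first clause of the definition. -/
theorem mem_finiteGap_of_mem_indexedChars {χ : X} (hT : χ ∈ T) (h : χ ∈ indexedChars T) :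
    χ ∈ finiteGap T := by
  obtain ⟨n, hn⟩ := h
  obtain ⟨a, ha, b, hb, rfl, -⟩ := isCharIndex_iff.1 hn
  exact mem_finiteGap_of_mul hT hb.1 (by simpa using ha)

theorem charInd_eq_ncard {χ : X} (hT : χ ∈ T) (h : χ ∈ indexedChars T) :
    charInd T χ = (coneGap T χ).ncard :=
  (isCharIndex_of_mem_finiteGap (mem_finiteGap_of_mem_indexedChars hT h)).charInd_eq

theorem charInd_nonneg {χ : X} (hT : χ ∈ T) (h : χ ∈ indexedChars T) : 0 ≤ charInd T χ := by
  rw [charInd_eq_ncard hT h]; positivity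

theorem indexedChars_convex {ξ₁ ξ₂ ξ : X} (h₁ : ξ₁ ∈ indexedChars T) (h₂ : ξ₂ ∈ indexedChars T)
    (hle₁ : ConeLE T ξ₁ ξ) (hle₂ : ConeLE T ξ ξ₂) : ξ ∈ indexedChars T := by
  have h : ξ * ξ₁⁻¹ * (ξ₂ * ξ⁻¹) = ξ₂ * ξ₁⁻¹ := by rw [mul_comm]; group
  have h₃ : ξ * ξ₁⁻¹ * (ξ₂ * ξ⁻¹) ∈ finiteGap T := by
    refine mem_finiteGap_of_mem_indexedChars (mul_mem hle₁ hle₂) ?_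
    rw [h]
    exact (indexSubgroup T).mul_mem h₂ ((indexSubgroup T).inv_mem h₁)
  have h₄ : ξ * ξ₁⁻¹ ∈ indexSubgroup T :=
    ⟨_, isCharIndex_of_mem_finiteGap (mem_finiteGap_of_mul hle₁ hle₂ h₃)⟩
  exact ((indexSubgroup T).mul_mem_cancel_right ((indexSubgroup T).inv_mem h₁)).1 h₄

theorem charInd_mono {ξ χ : X} (hξ : ξ ∈ indexedChars T) (hχ : χ ∈ indexedChars T)
    (h : ConeLE T ξ χ) : charInd T ξ ≤ charInd T χ := by
  have h' := charInd_nonneg h ((indexSubgroup T).mul_mem hχ ((indexSubgroup T).inv_mem hξ))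
  rw [charInd_mul hχ ((indexSubgroup T).inv_mem hξ), charInd_inv hξ] at h'
  omega

theorem exists_image_charInd_eq (T : GroupCone X) :
    ∃ a : ℕ, charInd T '' indexedChars T = {n : ℤ | ∃ m : ℤ, n = (a : ℤ) * m} := by
  obtain ⟨a, ha⟩ := Int.subgroup_cyclic (Subgroup.toAddSubgroup' (charIndHom T).range)
  refine ⟨a.natAbs, ?_⟩
  have h : ∀ n : ℤ, n ∈ charInd T '' indexedChars T ↔ n ∈ AddSubgroup.closure {a} := by
    intro n
    rw [← ha]
    constructor
    · rintro ⟨χ, hχ, rfl⟩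
      exact ⟨⟨χ, hχ⟩, rfl⟩
    · rintro ⟨χ, hχ⟩
      exact ⟨χ, χ.2, hχ⟩
  ext n
  rw [h, AddSubgroup.mem_closure_singleton, Set.mem_ofPred_eq]
  simp only [smul_eq_mul, mul_comm _ a]
  constructor
  · rintro ⟨m, rfl⟩
    exact Int.natAbs_dvd.2 (dvd_mul_right a m)
  · rintro ⟨m, rfl⟩
    obtain ⟨k, hk⟩ := Int.dvd_natAbs.2 (dvd_refl a)
    exact ⟨k * m, by rw [hk, mul_assoc]⟩

/-- An element of `T` of index `0` satisfies `T = χT`, so that `χ⁻¹ ∈ T`. -/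
theorem eq_one_of_charInd_eq_zero {χ : X} (hT : χ ∈ T) (h : χ ∈ indexedChars T)
    (h0 : charInd T χ = 0) : χ = 1 := by
  rw [charInd_eq_ncard hT h, Nat.cast_eq_zero,
    Set.ncard_eq_zero (mem_finiteGap_of_mem_indexedChars hT h).2] at h0
  have h1 : (1 : X) ∉ coneGap T χ := by simp [h0]
  refine eq_one_of_mem_of_inv_mem hT ?_
  simpa [mem_coneGap, one_mem T] using h1

theorem coneLE_of_charInd_le (hlin : ConeLinear T) {ξ χ : X} (hξ : ξ ∈ indexedChars T)
    (hχ : χ ∈ indexedChars T) (h : charInd T ξ ≤ charInd T χ) : ConeLE T ξ χ := by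
  rcases hlin (χ * ξ⁻¹) with h1 | h1
  · exact h1
  · have h2 := (indexSubgroup T).mul_mem hχ ((indexSubgroup T).inv_mem hξ)
    have h3 := charInd_mul hχ ((indexSubgroup T).inv_mem hξ)
    have h4 := charInd_nonneg h1 ((indexSubgroup T).inv_mem h2)
    rw [charInd_inv hξ] at h3
    rw [charInd_inv h2] at h4
    have h5 := eq_one_of_charInd_eq_zero h1 ((indexSubgroup T).inv_mem h2)
      (by rw [charInd_inv h2]; omega)
    rw [ConeLE, inv_eq_one.1 h5]
    exact one_mem T

theorem charInd_injOn (hlin : ConeLinear T) : Set.InjOn (charInd T) (indexedChars T) := by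
  intro ξ hξ χ hχ h
  have h1 := coneLE_of_charInd_le hlin hξ hχ h.le
  have h2 := coneLE_of_charInd_le hlin hχ hξ h.ge
  have h3 : χ * ξ⁻¹ = 1 := eq_one_of_mem_of_inv_mem h1 (by simpa [ConeLE] using h2)
  exact (mul_inv_eq_one.1 h3).symm

/-- If the image of the index is `aℤ` with `a > 0` and `χ` has index `a`, then `T \ χT` is the order
interval `[1, χ)`; its elements have indices in `[0, a)`, hence index `0`. Thus `T \ χT = {1}`, and
`a = 1`. -/
theorem charInd_surjOn (hlin : ConeLinear T) (hne : ∃ χ ∈ indexedChars T, χ ≠ 1) :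
    Set.SurjOn (charInd T) (indexedChars T) Set.univ := by
  obtain ⟨a, ha⟩ := exists_image_charInd_eq T
  have h1 : (1 : X) ∈ indexedChars T := (indexSubgroup T).one_mem
  have hone : charInd T (1 : X) = 0 := by
    rw [charInd_eq_ncard (one_mem T) h1]; simp [coneGap_one]
  have ha0 : a ≠ 0 := by
    rintro rfl
    obtain ⟨χ, hχ, hχ1⟩ := hne
    obtain ⟨m, hm⟩ : charInd T χ ∈ {n : ℤ | ∃ m : ℤ, n = ((0 : ℕ) : ℤ) * m} :=
      ha ▸ Set.mem_image_of_mem _ hχ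
    exact hχ1 (charInd_injOn hlin hχ h1 (by rw [hm, hone]; simp))
  obtain ⟨χ, hχ, hχa⟩ : (a : ℤ) ∈ charInd T '' indexedChars T := ha ▸ ⟨1, by simp⟩
  have hχT : χ ∈ T := by
    simpa [ConeLE] using coneLE_of_charInd_le hlin h1 hχ (by rw [hone, hχa]; positivity)
  have hgap : coneGap T χ ⊆ {1} := by
    intro ξ hξ
    obtain ⟨hξT, hξχ⟩ := mem_coneGap.1 hξ
    have hle : ConeLE T ξ χ := by
      simpa [ConeLE, mul_comm] using (hlin (χ⁻¹ * ξ)).resolve_left hξχ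
    have hξi : ξ ∈ indexedChars T :=
      indexedChars_convex h1 hχ (by simpa [ConeLE] using hξT) hle
    have hlt : charInd T ξ < a := by
      rw [← hχa]
      refine (charInd_mono hξi hχ hle).lt_of_ne fun h => hξχ ?_
      rw [charInd_injOn hlin hξi hχ h, inv_mul_cancel]
      exact one_mem T
    obtain ⟨m, hm⟩ : charInd T ξ ∈ {n : ℤ | ∃ m : ℤ, n = (a : ℤ) * m} :=
      ha ▸ Set.mem_image_of_mem _ hξi
    exact eq_one_of_charInd_eq_zero hξT hξi
      (Int.eq_zero_of_dvd_of_nonneg_of_lt (charInd_nonneg hξT hξi) hlt ⟨m, hm⟩)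
  have ha1 : a ≤ 1 := by
    have h := Set.ncard_le_ncard hgap
    rw [Set.ncard_singleton] at h
    have := charInd_eq_ncard hχT hχ
    omega
  obtain rfl : a = 1 := by omega
  rw [Set.SurjOn, ha]
  exact fun n _ => ⟨n, by simp⟩

end Cone

/-! ### Continuous logarithms of characters -/

/-- The functional equation `exp (g (x * y)) = exp (g x) * exp (g y)` makes
`g (x * y) - g x - g y` a continuous function with values in the countable set `2πiℤ`. On a
connected space it is constant. -/
theorem map_mul_add_map_one_of_exp_map_mul {A : Type*} [Monoid A] [TopologicalSpace A]
    [ContinuousMul A] [PreconnectedSpace A] {g : A → ℂ} (hg : Continuous g)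
    (hmul : ∀ x y, Complex.exp (g (x * y)) = Complex.exp (g x) * Complex.exp (g y)) (x y : A) :
    g (x * y) + g 1 = g x + g y := by
  let F : A × A → ℂ := fun p => g (p.1 * p.2) - (g p.1 + g p.2)
  have hF : Continuous F := by fun_prop
  have hexp : ∀ p, Complex.exp (F p) = 1 := fun p => by
    rw [Complex.exp_sub, Complex.exp_add, hmul, div_self]
    exact mul_ne_zero (Complex.exp_ne_zero _) (Complex.exp_ne_zero _)
  have hcount : (Set.range F).Countable := by
    refine (Set.countable_range fun n : ℤ => (n : ℂ) * (2 * Real.pi * Complex.I)).mono ?_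
    rintro _ ⟨p, rfl⟩
    obtain ⟨n, hn⟩ := Complex.exp_eq_one_iff.1 (hexp p)
    exact ⟨n, hn.symm⟩
  have hsub : (Set.range F).Subsingleton :=
    hcount.isTotallyDisconnected _ subset_rfl (isPreconnected_range hF)
  have h : F (x, y) = F (1, 1) := hsub ⟨_, rfl⟩ ⟨_, rfl⟩
  simp only [F, mul_one] at h
  linear_combination h

/-- A continuous logarithm on a compact connected group, normalized to vanish at the identity, is a
homomorphism with bounded image in `ℂ`, hence zero. -/
theorem eq_one_of_eq_exp {G : Type*} [CommGroup G] [TopologicalSpace G] [IsTopologicalGroup G]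
    [CompactSpace G] [PreconnectedSpace G] (χ : PontryaginDual G) (g : C(G, ℂ))
    (h : ∀ x, (χ x : ℂ) = Complex.exp (g x)) : χ = 1 := by
  have hadd := map_mul_add_map_one_of_exp_map_mul g.continuous
    (fun x y => by rw [← h, ← h, ← h, map_mul, Circle.coe_mul])
  have hpow : ∀ (x : G) (n : ℕ), g (x ^ n) - g 1 = n * (g x - g 1) := by
    intro x n
    induction n with
    | zero => simp
    | succ n ih =>
      rw [pow_succ]
      push_cast
      linear_combination hadd (x ^ n) x + ih
  have hzero : ∀ x, g x = g 1 := by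
    intro x
    by_contra hne
    have hpos : 0 < ‖g x - g 1‖ := norm_pos_iff.2 (sub_ne_zero.2 hne)
    obtain ⟨n, hn⟩ := exists_nat_gt (2 * ‖g‖ / ‖g x - g 1‖)
    rw [div_lt_iff₀ hpos] at hn
    have h1 : ‖g (x ^ n) - g 1‖ ≤ 2 * ‖g‖ := by
      refine (norm_sub_le _ _).trans ?_
      linarith [g.norm_coe_le_norm (x ^ n), g.norm_coe_le_norm 1]
    rw [hpow, norm_mul, Complex.norm_natCast] at h1
    linarith
  ext x
  rw [h, hzero, ← h, map_one, PontryaginDual.one_apply]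

/-! ### The cosets `χ · exp C(G)` -/

section Exponential

variable {A : Type*} [TopologicalSpace A]

/-- A continuous exponential as an invertible function. -/
noncomputable def expUnit (g : C(A, ℂ)) : C(A, ℂ)ˣ where
  val := ⟨fun x => Complex.exp (g x), by fun_prop⟩
  inv := ⟨fun x => Complex.exp (-g x), by fun_prop⟩
  val_inv := by ext x; simp [← Complex.exp_add]
  inv_val := by ext x; simp [← Complex.exp_add]

@[simp]
theorem expUnit_apply (g : C(A, ℂ)) (x : A) :
    (expUnit g : C(A, ℂ)) x = Complex.exp (g x) := rfl

theorem units_ext_apply {φ ψ : C(A, ℂ)ˣ}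
    (h : ∀ x, (φ : C(A, ℂ)) x = (ψ : C(A, ℂ)) x) : φ = ψ :=
  Units.ext (ContinuousMap.ext h)

theorem continuous_expUnit : Continuous (expUnit : C(A, ℂ) → C(A, ℂ)ˣ) := by
  have h := (ContinuousMap.mk Complex.exp Complex.continuous_exp).continuous_postcomp (X := A)
  exact Units.continuous_iff.2 ⟨h, h.comp continuous_neg⟩

end Exponential

section Cosets

variable {G : Type*} [CommGroup G] [TopologicalSpace G]

/-- A character as an invertible function. -/
noncomputable def charUnit (χ : PontryaginDual G) : C(G, ℂ)ˣ where
  val := ⟨fun x => (χ x : ℂ), by fun_prop⟩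
  inv := ⟨fun x => ((χ x)⁻¹ : Circle), by fun_prop⟩
  val_inv := by ext x; simp
  inv_val := by ext x; simp

@[simp]
theorem charUnit_apply (χ : PontryaginDual G) (x : G) :
    (charUnit χ : C(G, ℂ)) x = (χ x : ℂ) := rfl

theorem mem_expCoset_iff {χ : PontryaginDual G} {φ : C(G, ℂ)ˣ} :
    φ ∈ expCoset χ ↔ ∃ g : C(G, ℂ), φ = charUnit χ * expUnit g :=
  exists_congr fun g => ⟨fun h => units_ext_apply (by simpa using h), by rintro rfl; simp⟩

theorem charUnit_mem_expCoset (χ : PontryaginDual G) : charUnit χ ∈ expCoset χ :=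
  ⟨0, by simp⟩

theorem mul_mem_expCoset {ξ χ : PontryaginDual G} {φ ψ : C(G, ℂ)ˣ} (hφ : φ ∈ expCoset ξ)
    (hψ : ψ ∈ expCoset χ) : φ * ψ ∈ expCoset (ξ * χ) := by
  obtain ⟨f, hf⟩ := hφ
  obtain ⟨g, hg⟩ := hψ
  refine ⟨f + g, fun x => ?_⟩
  have h : (ξ * χ) x = ξ x * χ x := rfl
  simp only [Units.val_mul, ContinuousMap.mul_apply, hf, hg, h, Circle.coe_mul,
    ContinuousMap.add_apply, Complex.exp_add]
  ring

theorem inv_mem_expCoset {χ : PontryaginDual G} {φ : C(G, ℂ)ˣ} (hφ : φ ∈ expCoset χ) :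
    φ⁻¹ ∈ expCoset χ⁻¹ := by
  obtain ⟨g, rfl⟩ := mem_expCoset_iff.1 hφ
  refine mem_expCoset_iff.2 ⟨-g, inv_eq_of_mul_eq_one_right (units_ext_apply fun x => ?_)⟩
  have h : χ⁻¹ x = (χ x)⁻¹ := rfl
  simp only [Units.val_mul, ContinuousMap.mul_apply, charUnit_apply, expUnit_apply, h,
    Circle.coe_inv, ContinuousMap.neg_apply, Complex.exp_neg, Units.val_one,
    ContinuousMap.one_apply]
  have h1 : (χ x : ℂ) ≠ 0 := Circle.coe_ne_zero _
  have h2 : Complex.exp (g x) ≠ 0 := Complex.exp_ne_zero _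
  field_simp

variable (G) in
/-- The group `exp C(G)`. -/
def expSubgroup : Subgroup (C(G, ℂ)ˣ) where
  carrier := expCoset 1
  one_mem' := ⟨0, by simp⟩
  mul_mem' h₁ h₂ := by simpa using mul_mem_expCoset h₁ h₂
  inv_mem' h := by simpa using inv_mem_expCoset h

theorem mem_expCoset_iff_inv_mul_mem {χ : PontryaginDual G} {φ : C(G, ℂ)ˣ} :
    φ ∈ expCoset χ ↔ (charUnit χ)⁻¹ * φ ∈ expSubgroup G := by
  constructor
  · intro h
    have := mul_mem_expCoset (inv_mem_expCoset (charUnit_mem_expCoset χ)) h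
    rwa [inv_mul_cancel] at this
  · intro h
    have := mul_mem_expCoset (charUnit_mem_expCoset χ) h
    rwa [mul_inv_cancel_left, mul_one] at this

variable [CompactSpace G]

theorem isPreconnected_expCoset (χ : PontryaginDual G) : IsPreconnected (expCoset χ) := by
  have h : expCoset χ = Set.range fun g : C(G, ℂ) => charUnit χ * expUnit g := by
    ext φ
    rw [mem_expCoset_iff]
    exact exists_congr fun g => eq_comm
  rw [h]
  exact isPreconnected_range (continuous_const.mul continuous_expUnit)

/-- The unit ball around `1` consists of exponentials, by the principal branch of the logarithm. -/
theorem isOpen_expSubgroup : IsOpen (expSubgroup G : Set (C(G, ℂ)ˣ)) := by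
  refine Subgroup.isOpen_of_mem_nhds (g := 1) _ ?_
  refine Filter.mem_of_superset
    (Units.continuous_val.continuousAt.preimage_mem_nhds (Metric.ball_mem_nhds _ one_pos)) ?_
  intro φ hφ
  have hφ' : ‖(φ : C(G, ℂ)) - 1‖ < 1 := by simpa [dist_eq_norm] using hφ
  have hslit : ∀ x, (φ : C(G, ℂ)) x ∈ Complex.slitPlane := fun x => by
    have := Complex.mem_slitPlane_of_norm_lt_one
      (((φ : C(G, ℂ)) - 1).norm_coe_le_norm x |>.trans_lt hφ')
    simpa using this
  refine ⟨⟨fun x => Complex.log ((φ : C(G, ℂ)) x),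
    (φ : C(G, ℂ)).continuous.clog hslit⟩, fun x => ?_⟩
  simp [Complex.exp_log (Complex.slitPlane_ne_zero (hslit x))]

theorem isClopen_expCoset (χ : PontryaginDual G) : IsClopen (expCoset χ) := by
  have h : expCoset χ = (fun φ => (charUnit χ)⁻¹ * φ) ⁻¹' (expSubgroup G : Set (C(G, ℂ)ˣ)) :=
    Set.ext fun φ => mem_expCoset_iff_inv_mul_mem
  rw [h]
  exact IsClopen.preimage ⟨Subgroup.isClosed_of_isOpen _ isOpen_expSubgroup, isOpen_expSubgroup⟩
    (continuous_const_mul _)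

theorem eq_of_mem_expCoset [IsTopologicalGroup G] [PreconnectedSpace G]
    {ξ χ : PontryaginDual G} {φ : C(G, ℂ)ˣ} (hξ : φ ∈ expCoset ξ) (hχ : φ ∈ expCoset χ) :
    ξ = χ := by
  have h := mul_mem_expCoset hξ (inv_mem_expCoset hχ)
  rw [mul_inv_cancel] at h
  obtain ⟨g, hg⟩ := inv_mem_expCoset h
  refine mul_inv_eq_one.1 (eq_one_of_eq_exp (ξ * χ⁻¹) g fun x => ?_)
  have h1 := hg x
  have h2 : ((ξ * χ⁻¹)⁻¹ : PontryaginDual G) x = ((ξ * χ⁻¹) x)⁻¹ := rfl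
  rw [h2, Circle.coe_inv, inv_one, Units.val_one, ContinuousMap.one_apply] at h1
  field_simp at h1
  exact h1

end Cosets

/-! ### The index of invertible functions -/

section FunIndex

variable {G : Type*} [CommGroup G] [TopologicalSpace G] {T : GroupCone (PontryaginDual G)}

theorem mem_indexedFuns_iff {φ : C(G, ℂ)ˣ} :
    φ ∈ indexedFuns T ↔ ∃ χ ∈ indexedChars T, φ ∈ expCoset χ :=
  ⟨fun ⟨n, χ, h1, h2⟩ => ⟨χ, ⟨n, h2⟩, h1⟩, fun ⟨χ, ⟨n, h2⟩, h1⟩ => ⟨n, χ, h1, h2⟩⟩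

theorem indexedFuns_eq_iUnion : indexedFuns T = ⋃ χ ∈ indexedChars T, expCoset χ := by
  ext φ
  simp only [mem_indexedFuns_iff, Set.mem_iUnion, exists_prop]

variable (T) in
/-- The set `Φ(G)` as a subgroup. -/
def indexedFunsSubgroup : Subgroup (C(G, ℂ)ˣ) where
  carrier := indexedFuns T
  one_mem' := mem_indexedFuns_iff.2 ⟨1, (indexSubgroup T).one_mem, (expSubgroup G).one_mem⟩
  mul_mem' hφ hψ := by
    obtain ⟨ξ, hξ, hφ⟩ := mem_indexedFuns_iff.1 hφ
    obtain ⟨χ, hχ, hψ⟩ := mem_indexedFuns_iff.1 hψ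
    exact mem_indexedFuns_iff.2
      ⟨ξ * χ, (indexSubgroup T).mul_mem hξ hχ, mul_mem_expCoset hφ hψ⟩
  inv_mem' hφ := by
    obtain ⟨ξ, hξ, hφ⟩ := mem_indexedFuns_iff.1 hφ
    exact mem_indexedFuns_iff.2 ⟨ξ⁻¹, (indexSubgroup T).inv_mem hξ, inv_mem_expCoset hφ⟩

theorem isFunIndex_funInd {φ : C(G, ℂ)ˣ} (h : φ ∈ indexedFuns T) :
    IsFunIndex T φ (funInd T φ) := by
  have h' : ∃ n : ℤ, IsFunIndex T φ n := h
  rw [funInd, dif_pos h']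
  exact h'.choose_spec

variable [CompactSpace G]

theorem isOpen_indexedFuns (T : GroupCone (PontryaginDual G)) : IsOpen (indexedFuns T) := by
  rw [indexedFuns_eq_iUnion]
  exact isOpen_biUnion fun χ _ => (isClopen_expCoset χ).isOpen

theorem connectedComponentIn_indexedFuns {χ : PontryaginDual G} (hχ : χ ∈ indexedChars T)
    {φ : C(G, ℂ)ˣ} (hφ : φ ∈ expCoset χ) :
    connectedComponentIn (indexedFuns T) φ = expCoset χ := by
  have hφT : φ ∈ indexedFuns T := mem_indexedFuns_iff.2 ⟨χ, hχ, hφ⟩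
  refine (isPreconnected_connectedComponentIn.subset_isClopen (isClopen_expCoset χ)
    ⟨φ, mem_connectedComponentIn hφT, hφ⟩).antisymm ?_
  exact (isPreconnected_expCoset χ).subset_connectedComponentIn hφ
    fun ψ hψ => mem_indexedFuns_iff.2 ⟨χ, hχ, hψ⟩

variable [IsTopologicalGroup G] [PreconnectedSpace G]

theorem IsFunIndex.unique {φ : C(G, ℂ)ˣ} {m n : ℤ} (hm : IsFunIndex T φ m)
    (hn : IsFunIndex T φ n) : m = n := by
  obtain ⟨ξ, hξ, hm⟩ := hm
  obtain ⟨χ, hχ, hn⟩ := hn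
  obtain rfl := eq_of_mem_expCoset hξ hχ
  exact hm.unique hn

theorem funInd_eq_charInd {χ : PontryaginDual G} (hχ : χ ∈ indexedChars T) {φ : C(G, ℂ)ˣ}
    (hφ : φ ∈ expCoset χ) : funInd T φ = charInd T χ :=
  (isFunIndex_funInd (mem_indexedFuns_iff.2 ⟨χ, hχ, hφ⟩)).unique
    ⟨χ, hφ, isCharIndex_charInd hχ⟩

theorem funInd_mul {φ ψ : C(G, ℂ)ˣ} (hφ : φ ∈ indexedFuns T) (hψ : ψ ∈ indexedFuns T) :
    funInd T (φ * ψ) = funInd T φ + funInd T ψ := by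
  obtain ⟨ξ, hξ, hφ⟩ := mem_indexedFuns_iff.1 hφ
  obtain ⟨χ, hχ, hψ⟩ := mem_indexedFuns_iff.1 hψ
  rw [funInd_eq_charInd hξ hφ, funInd_eq_charInd hχ hψ,
    funInd_eq_charInd ((indexSubgroup T).mul_mem hξ hχ) (mul_mem_expCoset hφ hψ),
    charInd_mul hξ hχ]

end FunIndex

/-! ### Winding numbers along a homomorphism from the circle -/

theorem isWindingNumber_windingNumber (f : C(Circle, ℂ)ˣ) :
    IsWindingNumber f (windingNumber f) :=
  (existsUnique_isWindingNumber f).choose_spec.1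

theorem IsWindingNumber.windingNumber_eq {f : C(Circle, ℂ)ˣ} {n : ℤ} (h : IsWindingNumber f n) :
    windingNumber f = n :=
  (existsUnique_isWindingNumber f).unique (isWindingNumber_windingNumber f) h

theorem windingNumber_mul (f₁ f₂ : C(Circle, ℂ)ˣ) :
    windingNumber (f₁ * f₂) = windingNumber f₁ + windingNumber f₂ := by
  obtain ⟨g₁, h₁, hd₁⟩ := isWindingNumber_windingNumber f₁
  obtain ⟨g₂, h₂, hd₂⟩ := isWindingNumber_windingNumber f₂
  refine IsWindingNumber.windingNumber_eq ⟨g₁ + g₂, fun t => ?_, ?_⟩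
  · simp [h₁, h₂, Complex.exp_add]
  · simp only [ContinuousMap.add_apply]
    push_cast
    linear_combination hd₁ + hd₂

theorem windingNumber_expUnit (g : C(Circle, ℂ)) : windingNumber (expUnit g) = 0 :=
  IsWindingNumber.windingNumber_eq
    ⟨g.comp Circle.exp, fun t => by simp, by simp⟩

section Pullback

variable {G : Type*} [CommGroup G] [TopologicalSpace G] (γ : Circle →ₜ* G)

@[simp]
theorem pullbackUnit_apply (φ : C(G, ℂ)ˣ) (z : Circle) :
    (pullbackUnit γ φ : C(Circle, ℂ)) z = (φ : C(G, ℂ)) (γ z) := rfl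

/-- The degree of the character `χ ∘ γ` of the circle, as a homomorphism in `χ`. -/
noncomputable def pullbackDegree : PontryaginDual G →* Multiplicative ℤ :=
  MonoidHom.mk' (fun χ => Multiplicative.ofAdd (windingNumber (pullbackUnit γ (charUnit χ))))
    fun ξ χ => by
      rw [← ofAdd_add, ← windingNumber_mul]
      rfl

/-- Composing with `γ` turns the factor `exp g` into an exponential on the circle, which does not
wind. -/
theorem windingNumber_pullbackUnit {χ : PontryaginDual G} {φ : C(G, ℂ)ˣ} (hφ : φ ∈ expCoset χ) :
    windingNumber (pullbackUnit γ φ) = (pullbackDegree γ χ).toAdd := by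
  obtain ⟨g, rfl⟩ := mem_expCoset_iff.1 hφ
  have h : pullbackUnit γ (charUnit χ * expUnit g) =
      pullbackUnit γ (charUnit χ) * expUnit (g.comp (γ : C(Circle, G))) :=
    units_ext_apply fun z => rfl
  rw [h, windingNumber_mul, windingNumber_expUnit, add_zero]
  rfl

/-- A continuous logarithm of the homomorphism `t ↦ χ (γ (exp (it)))` on the line is affine. If the
winding number vanishes, it takes the same value at `0` and `2π`, and so it is constant. -/
theorem eq_one_of_pullbackDegree_eq_one {χ : PontryaginDual G} (h : pullbackDegree γ χ = 1)
    (z : Circle) : χ (γ z) = 1 := by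
  obtain ⟨g, hg, hd⟩ := isWindingNumber_windingNumber (pullbackUnit γ (charUnit χ))
  have h0 : windingNumber (pullbackUnit γ (charUnit χ)) = 0 := h
  rw [h0, Int.cast_zero, mul_zero, sub_eq_zero] at hd
  simp only [pullbackUnit_apply, charUnit_apply] at hg
  have : PreconnectedSpace (Multiplicative ℝ) := inferInstanceAs (PreconnectedSpace ℝ)
  have hexp : ∀ s t : ℝ, Complex.exp (g (s + t)) = Complex.exp (g s) * Complex.exp (g t) :=
    fun s t => by rw [← hg, ← hg, ← hg, Circle.exp_add, map_mul, map_mul, Circle.coe_mul]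
  have hadd : ∀ s t : ℝ, g (s + t) + g 0 = g s + g t :=
    map_mul_add_map_one_of_exp_map_mul (A := Multiplicative ℝ) (g := g) g.continuous hexp
  let L : ℝ →+ ℂ := AddMonoidHom.mk' (fun t => g t - g 0) fun s t => by
    linear_combination hadd s t
  have hL : Continuous L := by
    change Continuous fun t => g t - g 0
    fun_prop
  have hlin : ∀ t, L t = t • L 1 := fun t => by
    simpa using (L.toRealLinearMap hL).map_smul t 1
  have hL1 : L 1 = 0 := by
    have h2 : L (2 * Real.pi) = 0 := sub_eq_zero.2 hd
    rw [hlin] at h2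
    exact (smul_eq_zero.1 h2).resolve_left Real.two_pi_pos.ne'
  obtain ⟨t, rfl⟩ : ∃ t, Circle.exp t = z := ⟨_, Circle.exp_arg z⟩
  have ht : g t = g 0 := by
    have h3 := hlin t
    rw [hL1, smul_zero] at h3
    exact sub_eq_zero.1 h3
  apply Circle.ext
  rw [hg, ht, ← hg, Circle.exp_zero, map_one, map_one]

/-- Both the index and the degree along `γ` are homomorphisms on `X^i`, which is infinite cyclic;
the constant is the degree of the generator, the element of index `1`. -/
theorem exists_funInd_eq_inv_mul_windingNumber [IsTopologicalGroup G] [CompactSpace G]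
    [PreconnectedSpace G] {T : GroupCone (PontryaginDual G)} (hlin : ConeLinear T)
    (hγ : ¬ indexedChars T ⊆ charAnnihilator (Set.range γ)) :
    ∃ k : ℤ, k ≠ 0 ∧ ∀ φ ∈ indexedFuns T,
      (funInd T φ : ℚ) = (k : ℚ)⁻¹ * (windingNumber (pullbackUnit γ φ) : ℚ) := by
  obtain ⟨χ₁, hχ₁, hne⟩ := Set.not_subset.1 hγ
  have hχ₁_ne : χ₁ ≠ 1 := by
    rintro rfl
    exact hne fun _ _ => rfl
  obtain ⟨χ₀, hχ₀, h₀⟩ := charInd_surjOn hlin ⟨χ₁, hχ₁, hχ₁_ne⟩ (Set.mem_univ 1)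
  have hzpow : ∀ n : ℤ, charInd T (χ₀ ^ n) = n := fun n => by
    have h := congrArg Multiplicative.toAdd (map_zpow (charIndHom T) ⟨χ₀, hχ₀⟩ n)
    rw [toAdd_zpow] at h
    change charInd T (χ₀ ^ n) = n • charInd T χ₀ at h
    simpa [h₀] using h
  have hgen : ∀ χ ∈ indexedChars T, χ = χ₀ ^ charInd T χ := fun χ hχ =>
    charInd_injOn hlin hχ ((indexSubgroup T).zpow_mem hχ₀ _) (hzpow _).symm
  have hdeg : ∀ χ ∈ indexedChars T,
      (pullbackDegree γ χ).toAdd = charInd T χ * (pullbackDegree γ χ₀).toAdd := fun χ hχ => by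
    conv_lhs => rw [hgen χ hχ, map_zpow, toAdd_zpow, smul_eq_mul]
  have hk : (pullbackDegree γ χ₀).toAdd ≠ 0 := by
    intro h
    refine hne ?_
    rintro _ ⟨z, rfl⟩
    refine eq_one_of_pullbackDegree_eq_one γ (toAdd_eq_zero.1 ?_) z
    rw [hdeg χ₁ hχ₁, h, mul_zero]
  refine ⟨_, hk, fun φ hφ => ?_⟩
  obtain ⟨χ, hχ, hφ⟩ := mem_indexedFuns_iff.1 hφ
  rw [funInd_eq_charInd hχ hφ, windingNumber_pullbackUnit γ hφ, hdeg χ hχ,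
    eq_inv_mul_iff_mul_eq₀ (by exact_mod_cast hk)]
  push_cast
  ring

end Pullback

theorem mainTheorem5 {G : Type*} [CommGroup G] [TopologicalSpace G] [IsTopologicalGroup G]
    [CompactSpace G] [T2Space G] [ConnectedSpace G] [Nontrivial G]
    (T : GroupCone (PontryaginDual G)) (hT : ConeGenerates T) :
    -- (1) `X^i` is a convex subgroup
    ((∃ S : Subgroup (PontryaginDual G), (S : Set (PontryaginDual G)) = indexedChars T) ∧
      (∀ ξ₁ ∈ indexedChars T, ∀ ξ₂ ∈ indexedChars T, ∀ ξ : PontryaginDual G,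
        ConeLE T ξ₁ ξ → ConeLE T ξ ξ₂ → ξ ∈ indexedChars T)) ∧
    -- (2) `ind` on `X^i`
    ((∀ χ ∈ indexedChars T, ∃! n : ℤ, IsCharIndex T χ n) ∧
      (∀ ξ ∈ indexedChars T, ∀ χ ∈ indexedChars T,
        charInd T (ξ * χ) = charInd T ξ + charInd T χ) ∧
      (∀ ξ ∈ indexedChars T, ∀ χ ∈ indexedChars T,
        ConeLE T ξ χ → charInd T ξ ≤ charInd T χ) ∧
      (∃ a : ℕ, charInd T '' indexedChars T = {n : ℤ | ∃ m : ℤ, n = (a : ℤ) * m}) ∧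
      (ConeLinear T → (∃ χ ∈ indexedChars T, χ ≠ 1) →
        Set.BijOn (charInd T) (indexedChars T) Set.univ ∧
        ∀ ξ ∈ indexedChars T, ∀ χ ∈ indexedChars T,
          (charInd T ξ ≤ charInd T χ ↔ ConeLE T ξ χ))) ∧
    -- (3) `Φ(G)` is an open subgroup with the open components `χ exp C(G)`
    ((∃ S : Subgroup (C(G, ℂ)ˣ), (S : Set (C(G, ℂ)ˣ)) = indexedFuns T) ∧
      IsOpen (indexedFuns T) ∧
      indexedFuns T = (⋃ χ ∈ indexedChars T, expCoset χ) ∧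
      (indexedChars T).PairwiseDisjoint expCoset ∧
      (∀ χ ∈ indexedChars T, IsOpen (expCoset χ) ∧
        ∀ φ ∈ expCoset χ, connectedComponentIn (indexedFuns T) φ = expCoset χ)) ∧
    -- (4) `ind` on `Φ(G)`
    ((∀ φ ∈ indexedFuns T, ∃! n : ℤ, IsFunIndex T φ n) ∧
      (∀ φ ∈ indexedFuns T, ∀ ψ ∈ indexedFuns T,
        funInd T (φ * ψ) = funInd T φ + funInd T ψ) ∧
      (∀ χ ∈ indexedChars T, ∀ φ ∈ expCoset χ, funInd T φ = charInd T χ)) ∧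
    -- (5) the index through the classical winding number
    (ConeLinear T → ∀ γ : Circle →ₜ* G,
      ¬ indexedChars T ⊆ charAnnihilator (Set.range γ) →
      ∃ k : ℤ, k ≠ 0 ∧ ∀ φ ∈ indexedFuns T,
        (funInd T φ : ℚ) = (k : ℚ)⁻¹ * (windingNumber (pullbackUnit γ φ) : ℚ)) := by
  refine ⟨⟨⟨indexSubgroup T, rfl⟩, fun _ h₁ _ h₂ _ => indexedChars_convex h₁ h₂⟩,
    ⟨?_, fun _ hξ _ hχ => charInd_mul hξ hχ, fun _ hξ _ hχ => charInd_mono hξ hχ,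
      exists_image_charInd_eq T, fun hlin hne => ⟨⟨Set.mapsTo_univ _ _, charInd_injOn hlin,
        charInd_surjOn hlin hne⟩, fun _ hξ _ hχ =>
        ⟨coneLE_of_charInd_le hlin hξ hχ, charInd_mono hξ hχ⟩⟩⟩,
    ⟨⟨indexedFunsSubgroup T, rfl⟩, isOpen_indexedFuns T, indexedFuns_eq_iUnion, ?_,
      fun χ hχ => ⟨(isClopen_expCoset χ).isOpen,
        fun _ hφ => connectedComponentIn_indexedFuns hχ hφ⟩⟩,
    ⟨?_, fun _ hφ _ hψ => funInd_mul hφ hψ, fun _ hχ _ hφ => funInd_eq_charInd hχ hφ⟩,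
    fun hlin γ hγ => exists_funInd_eq_inv_mul_windingNumber γ hlin hγ⟩
  · exact fun χ hχ => ⟨_, isCharIndex_charInd hχ, fun n hn => hn.charInd_eq.symm⟩
  · exact fun ξ _ χ _ hne => Set.disjoint_left.2 fun φ hξ hχ => hne (eq_of_mem_expCoset hξ hχ)
  · exact fun φ hφ => ⟨_, isFunIndex_funInd hφ, fun n hn => hn.unique (isFunIndex_funInd hφ)⟩
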